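/- Let $m\ge 0$ and $q\ge 1$ be integers and let $C_{m,q}$ be the finite cyclic monoid of index $m$ and period $q$, i.e. the quotient of $(\mathbb N,+)$ by the congruence in which $x\sim y$ if and only if either $x=y<m$, or $x,y\ge m$ and $x\equiv y \bmod q$. For a monoid $M$ (written additively), let $\mathbb H M$ be its category of factorizations: its objects are the elements of $M$, its arrows are the triples $(x,y,z)\in M\times M\times M$, with $(x,y,z)\colon y\to x+y+z$, composition is $(u,x+y+z,v)(x,y,z)=(u+x,y,z+v)$, and the identity of $y$ is $(0,y,0)$. A left (right) $\mathbb H M$-module is a functor from $\mathbb H M$ (from $\mathbb H M^{op}$) to abelian groups, and $\mathbb Z$ denotes the constant left $\mathbb H M$-module with value $\mathbb Z$. For a left $\mathbb H M$-module $\mathcal A$ and a right $\mathbb H M$-module $\mathcal B$, the Leech cohomology and homology groups are $$\mathrm H^n(M,\mathcal A)=\mathrm{Ext}^n_{\mathbb H M}(\mathbb Z,\mathcal A),\qquad \mathrm H_n(M,\mathcal B)=\mathrm{Tor}_n^{\mathbb H M}(\mathcal B,\mathbb Z)=L_n(\mathcal B\otimes_{\mathbb H M}-)(\mathbb Z)\qquad(n\ge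 0),$$ where $\mathcal B\otimes_{\mathbb H M}\mathcal A$ is the coend of $(x,y)\mapsto \mathcal B(x)\otimes\mathcal A(y)$. **Proposition.** Let $\mathcal A$ be any left $\mathbb H C_{m,q}$-module and $\mathcal B$ any right $\mathbb H C_{m,q}$-module. 1. If $p,n\ge 3$ are integers with $p\equiv n \bmod 2q/\gcd(m,q)$, then there are isomorphisms of abelian groups $$\mathrm H^p(C_{m,q},\mathcal A)\cong \mathrm H^n(C_{m,q},\mathcal A),\qquad \mathrm H_p(C_{m,q},\mathcal B)\cong \mathrm H_n(C_{m,q},\mathcal B).$$ 2. If $m=1$, then there are also isomorphisms of abelian groups $$\mathrm H^n(C_{1,q},\mathcal A)\cong \mathrm H^2(C_{1,q},\mathcal A),\qquad \mathrm H_n(C_{1,q},\mathcal B)\cong \mathrm H_2(C_{1,q},\mathcal B)$$ for every integer $n\ge 2$ with $n\equiv 2\bmod 2q$. -/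

import Mathlib

open CategoryTheory Limits

universe u

/-! ### The category of factorizations of a monoid -/

/-- The objects of the category of factorizations `ℍM` of an additive monoid `M`: the elements
of `M`. -/
@[ext]
structure FactCat (M : Type) where
  /-- the underlying element of the monoid -/
  elt : M

namespace FactCat

/-- An arrow `y ⟶ w` of `ℍM` is a triple `(x, y, z)` with `x + y + z = w`. -/
@[ext]
structure Hom {M : Type} [AddMonoid M] (y w : FactCat M) where
  /-- the left factor `x` -/
  left : M
  /-- the right factor `z` -/
  right : M
  fac : left + y.elt + right = w.elt

/-- Identities are `(0, y, 0)`, and `(u, x + y + z, v) ∘ (x, y, z) = (u + x, y, z + v)`. -/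
instance {M : Type} [AddMonoid M] : SmallCategory (FactCat M) where
  Hom y w := Hom y w
  id y := ⟨0, 0, by simp⟩
  comp f g := ⟨g.left + f.left, f.right + g.right, by
    rw [← g.fac, ← f.fac]; simp only [add_assoc]⟩
  id_comp f := Hom.ext (add_zero _) (zero_add _)
  comp_id f := Hom.ext (zero_add _) (add_zero _)
  assoc f g h := Hom.ext (add_assoc _ _ _).symm (add_assoc _ _ _)

end FactCat

/-- Left `ℍM`-modules: functors from `ℍM` to abelian groups. -/
abbrev LeftHMod (M : Type) [AddMonoid M] := FactCat M ⥤ AddCommGrpCat.{u}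

/-- Right `ℍM`-modules: functors from the opposite of `ℍM` to abelian groups. -/
abbrev RightHMod (M : Type) [AddMonoid M] := (FactCat M)ᵒᵖ ⥤ AddCommGrpCat.{u}

/-- The trivial left `ℍM`-module `ℤ`: the constant functor (`ULift` only moves `ℤ` to the
universe of the coefficients). -/
def trivialHMod (M : Type) [AddMonoid M] : LeftHMod.{u} M :=
  (Functor.const (FactCat M)).obj (AddCommGrpCat.of (ULift.{u} ℤ))

/-! ### Enough projectives -/

theorem enoughProjectives_addCommGrpCat : EnoughProjectives AddCommGrpCat.{u} :=
  (Equivalence.enoughProjectives_iff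
    (forget₂ (ModuleCat.{u} ℤ) AddCommGrpCat.{u}).asEquivalence).1 inferInstance

theorem projective_sigmaObj {C : Type*} [Category* C] {β : Type*} (g : β → C) [HasCoproduct g]
    (h : ∀ b, Projective (g b)) : Projective (∐ g) where
  factors f e _ := ⟨Sigma.desc fun b => Projective.factorThru (Sigma.ι g b ≫ f) e,
    Sigma.hom_ext _ _ fun b => by simp⟩

instance enoughProjectives_leftHMod (M : Type) [AddMonoid M] :
    EnoughProjectives (LeftHMod.{u} M) where
  presentation A := by
    have := enoughProjectives_addCommGrpCat.{u}
    let P : FactCat M → LeftHMod.{u} M := fun x =>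
      (evaluationLeftAdjoint AddCommGrpCat.{u} x).obj (Projective.over (A.obj x))
    have hP : ∀ x, Projective (P x) := fun x =>
      (evaluationAdjunctionRight AddCommGrpCat.{u} x).map_projective _ inferInstance
    let f : ∀ x, P x ⟶ A := fun x =>
      ((evaluationAdjunctionRight AddCommGrpCat.{u} x).homEquiv _ A).symm
        (Projective.π (A.obj x))
    have hf : Epi (Sigma.desc f) := by
      rw [NatTrans.epi_iff_epi_app]
      intro x
      have h : (evaluationAdjunctionRight AddCommGrpCat.{u} x).unit.app _ ≫ (f x).app x =
          Projective.π (A.obj x) := by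
        have := (evaluationAdjunctionRight AddCommGrpCat.{u} x).homEquiv_unit
          (X := Projective.over (A.obj x)) (Y := A) (f := f x)
        simpa [f] using this.symm
      have h2 : (Sigma.ι P x).app x ≫ (Sigma.desc f).app x = (f x).app x := by
        rw [← NatTrans.comp_app, Sigma.ι_desc]
      rw [← h2, ← Category.assoc] at h
      have : Epi (((evaluationAdjunctionRight AddCommGrpCat.{u} x).unit.app _ ≫
          (Sigma.ι P x).app x) ≫ (Sigma.desc f).app x) := by
        rw [h]; infer_instance
      exact epi_of_epi ((evaluationAdjunctionRight AddCommGrpCat.{u} x).unit.app _ ≫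
          (Sigma.ι P x).app x) _
    exact ⟨{ p := ∐ P, projective := projective_sigmaObj P hP, f := Sigma.desc f, epi := hf }⟩

instance hasExt_leftHMod (M : Type) [AddMonoid M] : HasExt.{u} (LeftHMod.{u} M) :=
  hasExt_of_enoughProjectives _

/-! ### Leech cohomology -/

/-- `Hⁿ(M, A) = Extⁿ(ℤ, A)`, in the abelian category of left `ℍM`-modules. -/
abbrev LeechCohomology {M : Type} [AddMonoid M] (A : LeftHMod.{u} M) (n : ℕ) : Type u :=
  Abelian.Ext (trivialHMod.{u} M) A n

/-! ### The tensor product over `ℍM` -/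

namespace HTensor

variable {M : Type} [AddMonoid M]

/-- Generators `b ⊗ a`, with `b ∈ B(x)`, `a ∈ A(x)` and `x ∈ M`. -/
abbrev Gen (B : RightHMod.{u} M) (A : LeftHMod.{u} M) : Type u :=
  Σ x : FactCat M, (B.obj (Opposite.op x) : Type u) × (A.obj x : Type u)

/-- The generator `b ⊗ a` in the free abelian group. -/
def gen (B : RightHMod.{u} M) (A : LeftHMod.{u} M) (x : FactCat M)
    (b : B.obj (Opposite.op x)) (a : A.obj x) : FreeAbelianGroup (Gen B A) :=
  FreeAbelianGroup.of ⟨x, b, a⟩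

/-- The relators of the coend: biadditivity, and `(b f) ⊗ a = b ⊗ (f a)` for every arrow `f`
of `ℍM`. -/
inductive Rel (B : RightHMod.{u} M) (A : LeftHMod.{u} M) : FreeAbelianGroup (Gen B A) → Prop
  | add_left (x : FactCat M) (b b' : B.obj (Opposite.op x)) (a : A.obj x) :
      Rel B A (gen B A x (b + b') a - (gen B A x b a + gen B A x b' a))
  | add_right (x : FactCat M) (b : B.obj (Opposite.op x)) (a a' : A.obj x) :
      Rel B A (gen B A x b (a + a') - (gen B A x b a + gen B A x b a'))
  | balance {x y : FactCat M} (f : x ⟶ y) (b : B.obj (Opposite.op y)) (a : A.obj x) :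
      Rel B A (gen B A x (B.map f.op b) a - gen B A y b (A.map f a))

/-- The subgroup of relations. -/
def rels (B : RightHMod.{u} M) (A : LeftHMod.{u} M) :
    AddSubgroup (FreeAbelianGroup (Gen B A)) :=
  AddSubgroup.closure {z | Rel B A z}

/-- The tensor product `B ⊗_{ℍM} A`, an abelian group. -/
abbrev Obj (B : RightHMod.{u} M) (A : LeftHMod.{u} M) : Type u :=
  FreeAbelianGroup (Gen B A) ⧸ rels B A

/-- The element `b ⊗ a` of `B ⊗_{ℍM} A`. -/
def tmul (B : RightHMod.{u} M) (A : LeftHMod.{u} M) (x : FactCat M)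
    (b : B.obj (Opposite.op x)) (a : A.obj x) : Obj B A :=
  QuotientAddGroup.mk (gen B A x b a)

theorem tmul_add (B : RightHMod.{u} M) (A : LeftHMod.{u} M) (x : FactCat M)
    (b : B.obj (Opposite.op x)) (a a' : A.obj x) :
    tmul B A x b (a + a') = tmul B A x b a + tmul B A x b a' :=
  ((QuotientAddGroup.eq_iff_sub_mem (N := rels B A)).2
    (AddSubgroup.subset_closure (Rel.add_right x b a a')) :)

/-- The map `B ⊗ φ` on free abelian groups. -/
def preMap (B : RightHMod.{u} M) {A A' : LeftHMod.{u} M} (φ : A ⟶ A') :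
    FreeAbelianGroup (Gen B A) →+ FreeAbelianGroup (Gen B A') :=
  FreeAbelianGroup.map fun g => ⟨g.1, g.2.1, φ.app g.1 g.2.2⟩

theorem preMap_gen (B : RightHMod.{u} M) {A A' : LeftHMod.{u} M} (φ : A ⟶ A')
    (x : FactCat M) (b : B.obj (Opposite.op x)) (a : A.obj x) :
    preMap B φ (gen B A x b a) = gen B A' x b (φ.app x a) :=
  FreeAbelianGroup.map_of_apply _

theorem rels_le_comap (B : RightHMod.{u} M) {A A' : LeftHMod.{u} M} (φ : A ⟶ A') :
    rels B A ≤ (rels B A').comap (preMap B φ) := by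
  refine (AddSubgroup.closure_le _).2 ?_
  intro z hz
  refine AddSubgroup.subset_closure ?_
  rcases hz with ⟨x, b, b', a⟩ | ⟨x, b, a, a'⟩ | ⟨f, b, a⟩
  · simp only [map_sub, map_add, preMap_gen]
    exact Rel.add_left x b b' _
  · simp only [map_sub, map_add, preMap_gen]
    exact Rel.add_right x b _ _
  · simp only [map_sub, preMap_gen, NatTrans.naturality_apply]
    exact Rel.balance f b _

/-- The homomorphism `B ⊗ φ`, `b ⊗ a ↦ b ⊗ φ(a)`. -/
def map (B : RightHMod.{u} M) {A A' : LeftHMod.{u} M} (φ : A ⟶ A') : Obj B A →+ Obj B A' :=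
  QuotientAddGroup.map _ _ (preMap B φ) (rels_le_comap B φ)

theorem map_tmul (B : RightHMod.{u} M) {A A' : LeftHMod.{u} M} (φ : A ⟶ A')
    (x : FactCat M) (b : B.obj (Opposite.op x)) (a : A.obj x) :
    map B φ (tmul B A x b a) = tmul B A' x b (φ.app x a) :=
  congrArg QuotientAddGroup.mk (preMap_gen B φ x b a)

theorem hom_ext {B : RightHMod.{u} M} {A : LeftHMod.{u} M} {G : Type*} [AddCommGroup G]
    {f g : Obj B A →+ G}
    (h : ∀ x b a, f (tmul B A x b a) = g (tmul B A x b a)) : f = g := by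
  refine QuotientAddGroup.addMonoidHom_ext _ (FreeAbelianGroup.lift_ext _ _ ?_)
  rintro ⟨x, b, a⟩
  exact h x b a

end HTensor

/-- The functor `B ⊗_{ℍM} -` from left `ℍM`-modules to abelian groups. -/
def hTensor {M : Type} [AddMonoid M] (B : RightHMod.{u} M) :
    LeftHMod.{u} M ⥤ AddCommGrpCat.{u} where
  obj A := AddCommGrpCat.of (HTensor.Obj B A)
  map φ := AddCommGrpCat.ofHom (HTensor.map B φ)
  map_id A := by
    ext1
    refine HTensor.hom_ext fun x b a => ?_
    simp [HTensor.map_tmul]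
  map_comp φ ψ := by
    ext1
    refine HTensor.hom_ext fun x b a => ?_
    simp [HTensor.map_tmul]

instance hTensor_additive {M : Type} [AddMonoid M] (B : RightHMod.{u} M) :
    (hTensor B).Additive where
  map_add {A A' φ ψ} := by
    ext1
    refine HTensor.hom_ext fun x b a => ?_
    change HTensor.map B (φ + ψ) _ = HTensor.map B φ _ + HTensor.map B ψ _
    rw [HTensor.map_tmul, HTensor.map_tmul, HTensor.map_tmul]
    exact HTensor.tmul_add B A' x b _ _

/-! ### Leech homology -/

/-- `H_n(M, B) = Tor_n(B, ℤ)`: the `n`-th left derived functor of `B ⊗_{ℍM} -`, evaluated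
at the trivial module `ℤ`. -/
noncomputable abbrev LeechHomology {M : Type} [AddMonoid M] (B : RightHMod.{u} M) (n : ℕ) :
    AddCommGrpCat.{u} :=
  ((hTensor B).leftDerived n).obj (trivialHMod.{u} M)

/-! ### Finite cyclic monoids -/

/-- The congruence on `ℕ` of index `m` and period `q`. -/
def cyclicCon (m q : ℕ) : AddCon ℕ where
  r x y := (x = y ∧ x < m) ∨ (m ≤ x ∧ m ≤ y ∧ x ≡ y [MOD q])
  iseqv := by
    refine ⟨fun x => ?_, ?_, ?_⟩
    · rcases lt_or_ge x m with h | h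
      · exact Or.inl ⟨rfl, h⟩
      · exact Or.inr ⟨h, h, rfl⟩
    · rintro x y (⟨rfl, h⟩ | ⟨h, h', e⟩)
      · exact Or.inl ⟨rfl, h⟩
      · exact Or.inr ⟨h', h, e.symm⟩
    · rintro x y z (⟨rfl, h⟩ | ⟨h, h', e⟩) (⟨rfl, k⟩ | ⟨k, k', e'⟩)
      · exact Or.inl ⟨rfl, h⟩
      · omega
      · omega
      · exact Or.inr ⟨h, k', e.trans e'⟩
  add' := by
    rintro x y z w (⟨rfl, h⟩ | ⟨h, h', e⟩) (⟨rfl, k⟩ | ⟨k, k', e'⟩)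
    · rcases lt_or_ge (x + z) m with h | h
      · exact Or.inl ⟨rfl, h⟩
      · exact Or.inr ⟨h, h, rfl⟩
    · exact Or.inr ⟨by omega, by omega, e'.add_left x⟩
    · exact Or.inr ⟨by omega, by omega, e.add_right z⟩
    · exact Or.inr ⟨by omega, by omega, e.add e'⟩

/-- The cyclic monoid `C_{m,q}` of index `m` and period `q` (for `q ≥ 1`), written additively. -/
abbrev CyclicMonoid (m q : ℕ) : Type := (cyclicCon m q).Quotient

/-!
Let `M = C_{m,q}`. Left `ℍM`-modules for a commutative monoid `M` are the same as `M`-graded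
modules over the enveloping ring `ℤ[M × M]`, which for the cyclic monoid is
`ℤ[x, y] / (f(x), f(y))` with `f(t) = t ^ (m + q) - t ^ m`; the trivial module corresponds to
`ℤ[t] / f(t)`, on which `x` and `y` both act as `t`. As for every monogenic algebra, multiplication
by `x - y` and by the divided difference `(f(x) - f(y)) / (x - y)` alternately gives a free
resolution of it. Both elements are homogeneous: with `free s` the free `ℍM`-module on a generator
of degree `s`, and with `1` and `m` standing for their classes in `M`, the maps are
`x - y : free (s + 1) ⟶ free s` (`oddDiff`) and `norm : free (s + m) ⟶ free (s + 1)` (`evenDiff`).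
Explicit contracting homotopies show that
`free (s + m + 1) ⟶ free (s + m) ⟶ free (s + 1) ⟶ free s` is exact in the middle
(`exact_evenDiff_oddDiff`, `exact_oddDiff_evenDiff`), and that `coker (oddDiff 0)` is the trivial
module (`exact_oddDiff_aug`).

Dimension shifting along such sequences (`ShiftsTo.of_exact`) identifies the (co)homology in degree
`n + 2 * k`, `n ≥ 1`, with the derived functors in degree `n` of `coker (oddDiff (k * m))`, a module
that depends on `k` through the class of `k * m` in `M` only. For `k ≥ 1` one has `k * m ≥ m`, so
the class is determined by `k` modulo `q / gcd(m, q)`. If `m = 1`, then `norm` is an endomorphism of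
`free (s + 1)`, and one further shift leads to `coker (evenDiff s)`, which depends on `s + 1` only.
This includes the case `s = 0`, and gives the comparison with degree `2`.

`Ext` is shifted with its long exact sequence; for left derived functors, a projective resolution
of a syzygy is extended by one step (`ShortComplex.ShortExact.augmentResolution`).
-/

/-! ### Dimension shifting for `Ext` and for left derived functors -/

namespace CategoryTheory

variable {C : Type*} [Category* C] [Abelian C]

/-- Dimension shifting for `Ext` in the first variable. -/
theorem ShortComplex.ShortExact.nonempty_ext_addEquiv [HasExt.{u} C] {S : ShortComplex C}
    (hS : S.ShortExact) [Projective S.X₂] (A : C) (n : ℕ) :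
    Nonempty (Abelian.Ext S.X₃ A (n + 2) ≃+ Abelian.Ext S.X₁ A (n + 1)) := by
  refine ⟨(AddEquiv.ofBijective (hS.extClass.precomp A (add_comm 1 (n + 1))) ⟨?_, ?_⟩).symm⟩
  · rw [injective_iff_map_eq_zero]
    intro x hx
    obtain ⟨y, hy⟩ := Abelian.Ext.contravariant_sequence_exact₁ hS A x (add_comm 1 (n + 1)) hx
    rw [← hy, y.eq_zero_of_projective, Abelian.Ext.comp_zero]
  · intro x
    exact Abelian.Ext.contravariant_sequence_exact₃ hS A x
      (Abelian.Ext.eq_zero_of_projective _) (add_comm 1 (n + 1))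

/-- If `P ⟶ Q ⟶ R` is exact at `Q`, the map `coker (P ⟶ Q) ⟶ R` is a monomorphism with the
cokernel of `Q ⟶ R` as its cokernel. -/
theorem ShortComplex.Exact.shortExact_cokernelDesc {S : ShortComplex C} (hS : S.Exact) :
    (ShortComplex.mk (cokernel.desc S.f S.g S.zero) (cokernel.π S.g) (by
      rw [← cancel_epi (cokernel.π S.f)]; simp)).ShortExact where
  mono_f := hS.mono_cokernelDesc
  epi_g := inferInstanceAs (Epi (cokernel.π S.g))
  exact := by
    have h : (ShortComplex.mk S.g (cokernel.π S.g) (cokernel.condition _)).Exact :=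
      ShortComplex.exact_of_g_is_cokernel _ (cokernelIsCokernel S.g)
    let φ : ShortComplex.mk S.g (cokernel.π S.g) (cokernel.condition _) ⟶
        ShortComplex.mk (cokernel.desc S.f S.g S.zero) (cokernel.π S.g) (by
          rw [← cancel_epi (cokernel.π S.f)]; simp) :=
      { τ₁ := cokernel.π S.f, τ₂ := 𝟙 _, τ₃ := 𝟙 _ }
    have : Epi φ.τ₁ := inferInstanceAs (Epi (cokernel.π S.f))
    have : IsIso φ.τ₂ := inferInstanceAs (IsIso (𝟙 _))
    have : Mono φ.τ₃ := inferInstanceAs (Mono (𝟙 _))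
    exact (ShortComplex.exact_iff_of_epi_of_isIso_of_mono φ).1 h

variable [EnoughProjectives C]

/-- The augmentation of a projective resolution, with target the resolved object itself. -/
noncomputable def ProjectiveResolution.augmentation {X : C} (Q : ProjectiveResolution X) :
    Q.complex.X 0 ⟶ X :=
  Q.π.f 0

/-- Prepending `S.X₂` to a projective resolution of `S.X₁` yields a projective resolution
of `S.X₃`. -/
noncomputable def ShortComplex.ShortExact.augmentResolution {S : ShortComplex C}
    (hS : S.ShortExact) [Projective S.X₂] (Q : ProjectiveResolution S.X₁) :
    ProjectiveResolution S.X₃ :=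
  have hw : Q.complex.d 1 0 ≫ Q.augmentation ≫ S.f = 0 := by
    have : Q.complex.d 1 0 ≫ Q.augmentation = 0 := Q.complex_d_comp_π_f_zero
    rw [← Category.assoc, this, zero_comp]
  { complex := Q.complex.augment (Q.augmentation ≫ S.f) hw
    projective := fun n => match n with
      | 0 => inferInstanceAs (Projective S.X₂)
      | n + 1 => Q.projective n
    π := (ChainComplex.toSingle₀Equiv _ _).symm ⟨S.g, by
      change (Q.augmentation ≫ S.f) ≫ S.g = 0
      rw [Category.assoc, S.zero, comp_zero]⟩
    quasiIso := ⟨fun n => by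
      have := hS.mono_f
      have := hS.epi_g
      have : Epi Q.augmentation := inferInstanceAs (Epi (Q.π.f 0))
      match n with
      | 0 =>
        -- exactness at `S.X₂`: the map `Q₀ ⟶ S.X₂` has the same image as `S.f`
        rw [ChainComplex.quasiIsoAt₀_iff, ShortComplex.quasiIso_iff_of_zeros' _ rfl rfl rfl]
        let φ : ShortComplex.mk (Q.augmentation ≫ S.f) S.g (by simp) ⟶ S :=
          { τ₁ := Q.augmentation, τ₂ := 𝟙 _, τ₃ := 𝟙 _ }
        have : Epi φ.τ₁ := inferInstanceAs (Epi Q.augmentation)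
        have : IsIso φ.τ₂ := inferInstanceAs (IsIso (𝟙 _))
        have : Mono φ.τ₃ := inferInstanceAs (Mono (𝟙 _))
        have h := (ShortComplex.exact_iff_of_epi_of_isIso_of_mono φ).2 hS.exact
        refine (ShortComplex.exact_and_epi_g_iff_of_iso ?_).2
          ⟨h, inferInstanceAs (Epi S.g)⟩
        exact ShortComplex.isoMk (Iso.refl _) (Iso.refl _) (Iso.refl _)
          ((Category.id_comp _).trans (Category.comp_id _).symm)
          (((Category.id_comp S.g).trans (ChainComplex.toSingle₀Equiv_symm_apply_f_zero
            (C := Q.complex.augment (Q.augmentation ≫ S.f) hw) S.g _).symm).trans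
              (Category.comp_id _).symm)
      | 1 =>
        -- exactness at `Q₀`: as `S.f` is mono, `Q₀ ⟶ S.X₂` has the same kernel as `Q₀ ⟶ S.X₁`
        rw [quasiIsoAt_iff_exactAt' _ _ (ChainComplex.exactAt_succ_single_obj _ _),
          HomologicalComplex.exactAt_iff' _ 2 1 0 (by simp) (by simp)]
        let T := ShortComplex.mk (Q.complex.d 1 0) Q.augmentation Q.complex_d_comp_π_f_zero
        let φ : T ⟶ ShortComplex.mk (Q.complex.d 1 0) (Q.augmentation ≫ S.f) hw :=
          { τ₁ := 𝟙 _, τ₂ := 𝟙 _, τ₃ := S.f }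
        have : Epi φ.τ₁ := inferInstanceAs (Epi (𝟙 _))
        have : IsIso φ.τ₂ := inferInstanceAs (IsIso (𝟙 _))
        have : Mono φ.τ₃ := inferInstanceAs (Mono S.f)
        exact (ShortComplex.exact_iff_of_epi_of_isIso_of_mono φ).1 Q.exact₀
      | n + 2 =>
        rw [quasiIsoAt_iff_exactAt' _ _ (ChainComplex.exactAt_succ_single_obj _ _),
          HomologicalComplex.exactAt_iff' _ (n + 3) (n + 2) (n + 1) (by simp) (by simp)]
        exact Q.exact_succ n⟩ }

theorem ShortComplex.ShortExact.nonempty_leftDerived_iso {D : Type*} [Category* D] [Abelian D]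
    {S : ShortComplex C} (hS : S.ShortExact) [Projective S.X₂] (F : C ⥤ D) [F.Additive] (n : ℕ) :
    Nonempty ((F.leftDerived (n + 2)).obj S.X₃ ≅ (F.leftDerived (n + 1)).obj S.X₁) := by
  let Q := ProjectiveResolution.of S.X₁
  let P := hS.augmentResolution Q
  refine ⟨P.isoLeftDerivedObj F (n + 2) ≪≫ ?_ ≪≫ (Q.isoLeftDerivedObj F (n + 1)).symm⟩
  -- the two complexes have the same terms and differentials in the three degrees involved
  exact ShortComplex.homologyMapIso
    ((HomologicalComplex.isoSc' _ (n + 3) (n + 2) (n + 1) (by simp) (by simp)) ≪≫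
      ((HomologicalComplex.isoSc' ((F.mapHomologicalComplex _).obj Q.complex)
        (n + 2) (n + 1) n (by simp) (by simp))).symm)

end CategoryTheory

/-- Exactness in a category of functors can be checked pointwise. -/
theorem CategoryTheory.ShortComplex.exact_of_evaluation {J C : Type*} [Category* J] [Category* C]
    [Abelian C] (S : ShortComplex (J ⥤ C)) (h : ∀ j, (S.map ((evaluation J C).obj j)).Exact) :
    S.Exact := by
  rw [ShortComplex.exact_iff_isZero_homology]
  refine Functor.isZero _ fun j => ?_
  exact ((ShortComplex.exact_iff_isZero_homology _).1 (h j)).of_iso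
    (S.mapHomologyIso ((evaluation J C).obj j)).symm

/-! ### The enveloping ring and its grading -/

namespace FactCat

variable (M : Type)

/-- The enveloping ring `ℤ[M] ⊗ ℤ[M] = ℤ[M × M]` of `ℤ[M]`. -/
abbrev EnvRing : Type := AddMonoidAlgebra ℤ (M × M)

variable {M}

namespace EnvRing

/-- The basis element `(a, b)` of the enveloping ring. -/
noncomputable def basis (a b : M) : EnvRing M := AddMonoidAlgebra.single (a, b) 1

theorem addHom_ext {E : Type*} [AddCommGroup E] {f g : EnvRing M →+ E}
    (h : ∀ a b, f (basis a b) = g (basis a b)) : f = g :=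
  AddMonoidAlgebra.addHom_ext' fun p => by
    ext
    exact h p.1 p.2

/-- The additive map on the enveloping ring with prescribed values on the basis. -/
noncomputable def lift {E : Type*} [AddCommGroup E] (f : M → M → E) : EnvRing M →+ E :=
  (Finsupp.liftAddHom fun p => zmultiplesHom E (f p.1 p.2)).comp
    AddMonoidAlgebra.coeffAddEquiv.toAddMonoidHom

@[simp]
theorem lift_basis {E : Type*} [AddCommGroup E] (f : M → M → E) (a b : M) :
    lift f (basis a b) = f a b := by
  simp [lift, basis]

variable [AddCommMonoid M]

theorem basis_mul_basis (a b c d : M) : basis a b * basis c d = basis (a + c) (b + d) := by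
  simp [basis, AddMonoidAlgebra.single_mul_single]

theorem basis_pow (a b : M) (n : ℕ) : basis a b ^ n = basis (n • a) (n • b) := by
  simp [basis, AddMonoidAlgebra.single_pow]

/-- The subgroup of the enveloping ring spanned by the `(a, b)` with `a + s + b = y`; it is the
component of degree `y` of the free graded bimodule on a generator of degree `s`. -/
noncomputable def graded (s y : M) : AddSubgroup (EnvRing M) :=
  AddSubgroup.closure {c | ∃ a b, a + s + b = y ∧ c = basis a b}

theorem basis_mem {s y a b : M} (h : a + s + b = y) : basis a b ∈ graded s y :=
  AddSubgroup.subset_closure ⟨a, b, h, rfl⟩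

/-- An additive map sends `graded s y` to a subgroup if it does so on the basis. -/
theorem map_mem_of_basis {E : Type*} [AddCommGroup E] (f : EnvRing M →+ E) {s y : M}
    {H : AddSubgroup E} (h : ∀ a b, a + s + b = y → f (basis a b) ∈ H)
    {c : EnvRing M} (hc : c ∈ graded s y) : f c ∈ H := by
  have : graded s y ≤ H.comap f := (AddSubgroup.closure_le _).2 (by
    rintro _ ⟨a, b, hab, rfl⟩
    exact h a b hab)
  exact this hc

theorem mul_mem {s t y : M} {r c : EnvRing M} (hr : r ∈ graded t s) (hc : c ∈ graded s y) :
    r * c ∈ graded t y := by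
  refine map_mem_of_basis (AddMonoidHom.mulLeft r) (fun a b hab => ?_) hc
  refine map_mem_of_basis (AddMonoidHom.mulRight (basis a b)) (fun a' b' hab' => ?_) hr
  simp only [AddMonoidHom.coe_mulRight, basis_mul_basis]
  refine basis_mem ?_
  rw [← hab, ← hab']
  abel

/-- Additive maps that agree on the basis of `graded s y` agree on `graded s y`. -/
theorem eq_of_basis {E : Type*} [AddCommGroup E] (f g : EnvRing M →+ E) {s y : M}
    (h : ∀ a b, a + s + b = y → f (basis a b) = g (basis a b))
    {c : EnvRing M} (hc : c ∈ graded s y) : f c = g c := by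
  have : c ∈ graded s y → (f - g) c ∈ (⊥ : AddSubgroup E) :=
    map_mem_of_basis _ fun a b hab => by simp [h a b hab]
  simpa [sub_eq_zero] using this hc

theorem basis_mul_mem {s : M} {y y' : FactCat M} (f : y ⟶ y') {c : EnvRing M}
    (hc : c ∈ graded s y.elt) : basis f.left f.right * c ∈ graded s y'.elt := by
  rw [mul_comm]
  refine map_mem_of_basis (AddMonoidHom.mulRight (basis f.left f.right)) (fun a b hab => ?_) hc
  simp only [AddMonoidHom.coe_mulRight, basis_mul_basis]
  refine basis_mem ?_
  refine Eq.trans ?_ f.fac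
  rw [← hab]
  abel

end EnvRing

/-! ### Free modules over the category of factorizations -/

open EnvRing

variable [AddCommMonoid M]

/-- The map on graded pieces induced by an additive map of the enveloping ring. -/
noncomputable def gradedMap {s t y y' : M} (f : EnvRing M →+ EnvRing M)
    (hf : ∀ c ∈ graded s y, f c ∈ graded t y') :
    ULift.{u, 0} (graded s y) →+ ULift.{u, 0} (graded t y') :=
  (AddEquiv.ulift.symm.toAddMonoidHom.comp
    ((f.comp (graded s y).subtype).codRestrict (graded t y') fun c => hf c c.2)).comp
      AddEquiv.ulift.toAddMonoidHom

theorem ulift_graded_ext {s y : M} {c d : ULift.{u, 0} (graded s y)} (h : c.down.1 = d.down.1) :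
    c = d :=
  ULift.ext c d (Subtype.ext h)

/-- The free left `ℍM`-module on a generator of degree `s`: in degree `y` it is the free abelian
group on the arrows `s ⟶ y` of `ℍM`. -/
noncomputable def free (s : M) : LeftHMod.{u} M where
  obj y := AddCommGrpCat.of (ULift.{u, 0} (graded s y.elt))
  map f := AddCommGrpCat.ofHom
    (gradedMap (AddMonoidHom.mulLeft (basis f.left f.right)) fun _ => basis_mul_mem f)
  map_id y := by
    refine AddCommGrpCat.hom_ext (AddMonoidHom.ext fun c => ?_)
    refine ulift_graded_ext (c := gradedMap _ (fun _ => basis_mul_mem (𝟙 y)) c) ?_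
    exact one_mul c.down.1
  map_comp f g := by
    refine AddCommGrpCat.hom_ext (AddMonoidHom.ext fun c => ?_)
    refine ulift_graded_ext (c := gradedMap _ (fun _ => basis_mul_mem (f ≫ g)) c) ?_
    change basis _ _ * c.down.1 = basis _ _ * (basis _ _ * c.down.1)
    rw [← mul_assoc, basis_mul_basis]
    congr 2
    exact add_comm _ _

namespace free

/-- The element of `free s` given by a homogeneous element of the enveloping ring. -/
def mk {s : M} (y : FactCat M) (c : EnvRing M) (hc : c ∈ graded s y.elt) :
    (free.{u} s).obj y :=
  (ULift.up ⟨c, hc⟩ : ULift.{u, 0} (graded s y.elt))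

/-- The homogeneous element of the enveloping ring underlying an element of `free s`. -/
noncomputable def val (s : M) (y : FactCat M) : (free.{u} s).obj y →+ EnvRing M :=
  (graded s y.elt).subtype.comp
    (AddEquiv.ulift.toAddMonoidHom : ULift.{u, 0} (graded s y.elt) →+ graded s y.elt)

theorem val_mem {s : M} {y : FactCat M} (c : (free.{u} s).obj y) :
    val s y c ∈ graded s y.elt :=
  (ULift.down (α := graded s y.elt) c).2

theorem val_injective {s : M} {y : FactCat M} : Function.Injective (val.{u} s y) :=
  fun _ _ h => ulift_graded_ext h

/-- The generator of `free s`. -/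
noncomputable def gen (s : M) : (free.{u} s).obj ⟨s⟩ :=
  mk ⟨s⟩ 1 (basis_mem (by simp))

open Classical in
/-- For `e : E(s)`, the additive map sending `(a, b)` to the image of `e` under the arrow `(a, b)`
from `s` to `y` if `a + s + b = y`, and to `0` otherwise. -/
noncomputable def descAux {s : M} {E : LeftHMod.{u} M} (e : E.obj ⟨s⟩) (y : FactCat M) :
    EnvRing M →+ E.obj y :=
  EnvRing.lift fun a b =>
    if h : a + s + b = y.elt then E.map (⟨a, b, h⟩ : (⟨s⟩ : FactCat M) ⟶ y) e else 0

theorem descAux_basis {s : M} {E : LeftHMod.{u} M} (e : E.obj ⟨s⟩) {y : FactCat M} {a b : M}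
    (h : a + s + b = y.elt) :
    descAux e y (basis a b) = E.map (⟨a, b, h⟩ : (⟨s⟩ : FactCat M) ⟶ y) e :=
  (lift_basis _ a b).trans (dif_pos h)

/-- The map out of a free module determined by the image of the generator. -/
noncomputable def desc {s : M} {E : LeftHMod.{u} M} (e : E.obj ⟨s⟩) : free.{u} s ⟶ E where
  app y := AddCommGrpCat.ofHom ((descAux e y).comp (val s y))
  naturality y y' f := by
    ext c
    refine eq_of_basis ((descAux e y').comp (AddMonoidHom.mulLeft (basis f.left f.right)))
      ((E.map f).hom.comp (descAux e y)) (fun a b hab => ?_) (val_mem c)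
    have hab' : (f.left + a) + s + (b + f.right) = y'.elt := by
      refine Eq.trans ?_ f.fac
      rw [← hab]
      abel
    rw [AddMonoidHom.comp_apply, AddMonoidHom.comp_apply, AddMonoidHom.coe_mulLeft,
      basis_mul_basis, add_comm f.right b, descAux_basis e hab', descAux_basis e hab]
    exact ConcreteCategory.congr_hom
      (E.map_comp (⟨a, b, hab⟩ : (⟨s⟩ : FactCat M) ⟶ y) f) e

theorem desc_gen {s : M} {E : LeftHMod.{u} M} (e : E.obj ⟨s⟩) :
    (desc e).app ⟨s⟩ (gen s) = e :=
  (descAux_basis e (a := 0) (b := 0) (y := ⟨s⟩) (by simp)).trans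
    (ConcreteCategory.congr_hom (E.map_id ⟨s⟩) e)

/-- Maps out of a free module that agree on the generator are equal. -/
theorem hom_ext {s : M} {E : LeftHMod.{u} M} {f g : free.{u} s ⟶ E}
    (h : f.app ⟨s⟩ (gen s) = g.app ⟨s⟩ (gen s)) : f = g := by
  ext y c
  change f.app y (mk y (val s y c) (val_mem c)) = g.app y (mk y (val s y c) (val_mem c))
  generalize val_mem c = hc
  generalize val s y c = d at hc
  refine AddSubgroup.closure_induction
    (p := fun d hd => f.app y (mk y d hd) = g.app y (mk y d hd)) ?_ ?_ ?_ ?_ hc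
  · rintro _ ⟨a, b, hab, rfl⟩
    let k : (⟨s⟩ : FactCat M) ⟶ y := ⟨a, b, hab⟩
    have : mk.{u} y (basis a b) (basis_mem hab) = (free s).map k (gen s) :=
      val_injective (mul_one _).symm
    rw [this, NatTrans.naturality_apply, NatTrans.naturality_apply, h]
  · exact (map_zero (f.app y).hom).trans (map_zero (g.app y).hom).symm
  · intro x z hx hz ex ez
    exact (map_add (f.app y).hom (mk y x hx) (mk y z hz)).trans
      ((congrArg₂ (· + ·) ex ez).trans (map_add (g.app y).hom (mk y x hx) (mk y z hz)).symm)
  · intro x hx ex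
    exact (map_neg (f.app y).hom (mk y x hx)).trans
      ((congrArg Neg.neg ex).trans (map_neg (g.app y).hom (mk y x hx)).symm)

instance (s : M) : Projective (free.{u} s) where
  factors f e _ := by
    have : Function.Surjective (e.app ⟨s⟩) := by
      rw [← AddCommGrpCat.epi_iff_surjective]
      exact (NatTrans.epi_iff_epi_app e).1 inferInstance _
    obtain ⟨x, hx⟩ := this (f.app ⟨s⟩ (gen s))
    refine ⟨desc x, hom_ext ?_⟩
    change e.app ⟨s⟩ ((desc x).app ⟨s⟩ (gen s)) = _
    rw [desc_gen, hx]

/-- A homogeneous element `r` of the enveloping ring gives the map `free s ⟶ free t` sending the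
generator to `r`. -/
noncomputable def mul {s t : M} (r : EnvRing M) (hr : r ∈ graded t s) :
    free.{u} s ⟶ free.{u} t where
  app y := AddCommGrpCat.ofHom (gradedMap (AddMonoidHom.mulLeft r) fun _ => mul_mem hr)
  naturality y y' f := by
    ext c
    exact val_injective (mul_left_comm r (basis f.left f.right) (val s y c))

theorem mul_comp_mul {s t v : M} {r r' : EnvRing M} (hr : r ∈ graded t s) (hr' : r' ∈ graded v t)
    (h : r' * r = 0) : mul.{u} r hr ≫ mul.{u} r' hr' = 0 := by
  ext y c
  refine val_injective ?_
  change r' * (r * val s y c) = 0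
  rw [← mul_assoc, h, zero_mul]

/-- Exactness of a sequence of free modules, checked on homogeneous elements. -/
theorem exact_mul {s t v : M} {r r' : EnvRing M} (hr : r ∈ graded t s) (hr' : r' ∈ graded v t)
    (h : r' * r = 0)
    (hex : ∀ y, ∀ c ∈ graded t y, r' * c = 0 → ∃ d ∈ graded s y, r * d = c) :
    (ShortComplex.mk _ _ (mul_comp_mul.{u} hr hr' h)).Exact := by
  refine ShortComplex.exact_of_evaluation _ fun y => ?_
  rw [ShortComplex.ab_exact_iff]
  intro c hc
  obtain ⟨d, hd, e⟩ := hex y.elt (val t y c) (val_mem c)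
    ((congrArg (val v y) hc).trans (map_zero _))
  exact ⟨mk y d hd, val_injective e⟩

end free

end FactCat

/-! ### The enveloping ring of a finite cyclic monoid -/

namespace CyclicMonoid

open FactCat EnvRing

variable (m q : ℕ)

/-- The class of a natural number in the cyclic monoid. -/
def cls : ℕ →+ CyclicMonoid m q :=
  (cyclicCon m q).mk'

variable {m q}

theorem cls_eq_cls {i j : ℕ} :
    cls m q i = cls m q j ↔ (i = j ∧ i < m) ∨ (m ≤ i ∧ m ≤ j ∧ i ≡ j [MOD q]) :=
  (cyclicCon m q).eq

theorem cls_surjective : Function.Surjective (cls m q) :=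
  AddCon.mk'_surjective

theorem cls_index_add_period : cls m q (m + q) = cls m q m :=
  cls_eq_cls.2 (Or.inr ⟨by omega, le_rfl, by simp [Nat.ModEq]⟩)

theorem cls_injOn {i j : ℕ} (hi : i < m + q) (hj : j < m + q) (h : cls m q i = cls m q j) :
    i = j := by
  rcases cls_eq_cls.1 h with ⟨h, -⟩ | ⟨h1, h2, h3⟩
  · exact h
  · have h4 : (i - m) + m ≡ (j - m) + m [MOD q] := by
      rwa [Nat.sub_add_cancel h1, Nat.sub_add_cancel h2]
    have := (Nat.ModEq.add_right_cancel' m h4).eq_of_lt_of_lt (by omega) (by omega)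
    omega

theorem exists_lt_cls_eq (hq : 1 ≤ q) (a : CyclicMonoid m q) : ∃ i < m + q, cls m q i = a := by
  obtain ⟨i, rfl⟩ := cls_surjective a
  rcases lt_or_ge i m with h | h
  · exact ⟨i, by omega, rfl⟩
  · have := Nat.mod_lt (i - m) hq
    refine ⟨m + (i - m) % q, by omega, cls_eq_cls.2 (Or.inr ⟨by omega, h, ?_⟩)⟩
    have := (Nat.mod_modEq (i - m) q).add_left m
    rwa [Nat.add_sub_cancel' h] at this

open Classical in
/-- The representative in `{0, …, m + q - 1}` of an element of the cyclic monoid. It exists if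
`q ≥ 1`; the value `0` otherwise is irrelevant. -/
noncomputable def rep (a : CyclicMonoid m q) : ℕ :=
  if h : ∃ i < m + q, cls m q i = a then h.choose else 0

theorem rep_cls {i : ℕ} (hi : i < m + q) : rep (cls m q i) = i := by
  have h : ∃ j < m + q, cls m q j = cls m q i := ⟨i, hi, rfl⟩
  rw [rep, dif_pos h]
  exact cls_injOn h.choose_spec.1 hi h.choose_spec.2

variable (m q)

/-- The left variable of the enveloping ring `ℤ[x, y] / (x ^ (m + q) - x ^ m, y ^ (m + q) - y ^ m)`
of the cyclic monoid. -/
noncomputable def x : EnvRing (CyclicMonoid m q) := basis (cls m q 1) 0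

/-- The right variable of the enveloping ring of the cyclic monoid. -/
noncomputable def y : EnvRing (CyclicMonoid m q) := basis 0 (cls m q 1)

/-- The divided difference `(x ^ n - y ^ n) / (x - y)`. -/
noncomputable def dd (n : ℕ) : EnvRing (CyclicMonoid m q) :=
  ∑ i ∈ Finset.range n, x m q ^ i * y m q ^ (n - 1 - i)

/-- The divided difference of the polynomial `t ^ (m + q) - t ^ m`. -/
noncomputable def norm : EnvRing (CyclicMonoid m q) := dd m q (m + q) - dd m q m

variable {m q}

theorem x_pow (i : ℕ) : x m q ^ i = basis (cls m q i) 0 := by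
  rw [x, basis_pow, ← map_nsmul]; simp

theorem y_pow (j : ℕ) : y m q ^ j = basis 0 (cls m q j) := by
  rw [y, basis_pow, ← map_nsmul]; simp

theorem x_pow_mul_y_pow (i j : ℕ) : x m q ^ i * y m q ^ j = basis (cls m q i) (cls m q j) := by
  rw [x_pow, y_pow, basis_mul_basis, add_zero, zero_add]

theorem x_pow_index_add_period : x m q ^ (m + q) = x m q ^ m := by
  rw [x_pow, x_pow, cls_index_add_period]

theorem y_pow_index_add_period : y m q ^ (m + q) = y m q ^ m := by
  rw [y_pow, y_pow, cls_index_add_period]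

theorem sub_mul_dd (n : ℕ) : (x m q - y m q) * dd m q n = x m q ^ n - y m q ^ n :=
  (Commute.all _ _).mul_geom_sum₂ n

theorem dd_succ (n : ℕ) : dd m q (n + 1) = x m q ^ n + y m q * dd m q n :=
  geom_sum₂_succ_eq _ _

theorem sub_mul_norm : (x m q - y m q) * norm m q = 0 := by
  rw [norm, mul_sub, sub_mul_dd, sub_mul_dd, x_pow_index_add_period, y_pow_index_add_period,
    sub_self]

theorem norm_mul_sub : norm m q * (x m q - y m q) = 0 := by
  rw [mul_comm, sub_mul_norm]

theorem norm_mul_x_pow (i : ℕ) : norm m q * x m q ^ i = norm m q * y m q ^ i := by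
  rw [← sub_eq_zero, ← mul_sub, ← sub_mul_dd, ← mul_assoc, norm_mul_sub, zero_mul]

/-- The monomials `x ^ i * y ^ j` with `i < m + q` span the enveloping ring. -/
theorem eq_of_monomials (hq : 1 ≤ q) {E : Type*} [AddCommGroup E]
    (f g : EnvRing (CyclicMonoid m q) →+ E)
    (h : ∀ i j, i < m + q → f (x m q ^ i * y m q ^ j) = g (x m q ^ i * y m q ^ j)) : f = g := by
  refine addHom_ext fun a b => ?_
  obtain ⟨i, hi, rfl⟩ := exists_lt_cls_eq hq a
  obtain ⟨j, rfl⟩ := cls_surjective b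
  rw [← x_pow_mul_y_pow]
  exact h i j hi

variable (m q)

/-- The contracting homotopy `x ^ i * y ^ j ↦ (x ^ i - y ^ i) / (x - y) * y ^ j`, `i < m + q`. -/
noncomputable def evenHomotopy : EnvRing (CyclicMonoid m q) →+ EnvRing (CyclicMonoid m q) :=
  EnvRing.lift fun a b => dd m q (rep a) * basis 0 b

/-- The contracting homotopy sending `x ^ (m + q - 1) * y ^ j` to `y ^ j` and the other monomials
`x ^ i * y ^ j`, `i < m + q - 1`, to `0`. -/
noncomputable def oddHomotopy : EnvRing (CyclicMonoid m q) →+ EnvRing (CyclicMonoid m q) :=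
  EnvRing.lift fun a b => if rep a + 1 = m + q then basis 0 b else 0

variable {m q}

theorem evenHomotopy_monomial {i : ℕ} (hi : i < m + q) (j : ℕ) :
    evenHomotopy m q (x m q ^ i * y m q ^ j) = dd m q i * y m q ^ j := by
  rw [x_pow_mul_y_pow, evenHomotopy, lift_basis, rep_cls hi, y_pow]

theorem oddHomotopy_monomial {i : ℕ} (hi : i < m + q) (j : ℕ) :
    oddHomotopy m q (x m q ^ i * y m q ^ j) = if i + 1 = m + q then y m q ^ j else 0 := by
  rw [x_pow_mul_y_pow, oddHomotopy, lift_basis, rep_cls hi, y_pow]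

/-- `oddHomotopy` picks out the coefficient of `x ^ (m + q - 1)`; in `norm` it is `1`. -/
theorem oddHomotopy_norm (hq : 1 ≤ q) (j : ℕ) :
    oddHomotopy m q (norm m q * y m q ^ j) = y m q ^ j := by
  have key : ∀ n ≤ m + q, oddHomotopy m q (dd m q n * y m q ^ j) =
      if n = m + q then y m q ^ j else 0 := by
    intro n hn
    rcases n with _ | n
    · rw [if_neg (by omega), dd, Finset.range_zero, Finset.sum_empty, zero_mul, map_zero]
    · rw [dd, Finset.sum_range_succ, add_mul, map_add, Finset.sum_mul, map_sum,
        Finset.sum_eq_zero, zero_add, mul_assoc, ← pow_add, oddHomotopy_monomial (by omega)]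
      · simp
      · intro i hi
        rw [Finset.mem_range] at hi
        rw [mul_assoc, ← pow_add, oddHomotopy_monomial (by omega), if_neg (by omega)]
  rw [norm, sub_mul, map_sub, key _ le_rfl, key m (by omega), if_pos rfl, if_neg (by omega),
    sub_zero]

/-- The homotopy identity in odd degrees of the resolution. -/
theorem norm_mul_oddHomotopy_add (hq : 1 ≤ q) (c : EnvRing (CyclicMonoid m q)) :
    norm m q * oddHomotopy m q c + evenHomotopy m q ((x m q - y m q) * c) = c := by
  refine DFunLike.congr_fun (eq_of_monomials hq
    ((AddMonoidHom.mulLeft (norm m q)).comp (oddHomotopy m q) +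
      (evenHomotopy m q).comp (AddMonoidHom.mulLeft (x m q - y m q)))
    (AddMonoidHom.id _) fun i j hi => ?_) c
  have e : (x m q - y m q) * (x m q ^ i * y m q ^ j) =
      x m q ^ (i + 1) * y m q ^ j - x m q ^ i * y m q ^ (j + 1) := by ring
  simp only [AddMonoidHom.add_apply, AddMonoidHom.comp_apply, AddMonoidHom.coe_mulLeft,
    AddMonoidHom.id_apply]
  rw [e, map_sub, oddHomotopy_monomial hi, evenHomotopy_monomial hi]
  rcases eq_or_ne (i + 1) (m + q) with h | h
  · -- the monomial `x ^ (m + q)` has to be reduced to `x ^ m` before the homotopy is applied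
    rw [if_pos h, h, x_pow_index_add_period, evenHomotopy_monomial (by omega), norm, ← h, dd_succ]
    ring
  · rw [if_neg h, evenHomotopy_monomial (by omega), dd_succ]
    ring

/-- The homotopy identity in positive even degrees of the resolution. -/
theorem sub_mul_evenHomotopy_add (hq : 1 ≤ q) (c : EnvRing (CyclicMonoid m q)) :
    (x m q - y m q) * evenHomotopy m q c + oddHomotopy m q (norm m q * c) = c := by
  refine DFunLike.congr_fun (eq_of_monomials hq
    ((AddMonoidHom.mulLeft (x m q - y m q)).comp (evenHomotopy m q) +
      (oddHomotopy m q).comp (AddMonoidHom.mulLeft (norm m q)))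
    (AddMonoidHom.id _) fun i j hi => ?_) c
  simp only [AddMonoidHom.add_apply, AddMonoidHom.comp_apply, AddMonoidHom.coe_mulLeft,
    AddMonoidHom.id_apply]
  rw [evenHomotopy_monomial hi, ← mul_assoc, sub_mul_dd, ← mul_assoc, norm_mul_x_pow, mul_assoc,
    ← pow_add, oddHomotopy_norm hq]
  ring

/-! ### Degrees of the differentials and homotopies -/

theorem dd_mem {n : ℕ} {s t : CyclicMonoid m q} (h : ∀ k, n = k + 1 → cls m q k + s = t) :
    dd m q n ∈ graded s t := by
  refine AddSubgroup.sum_mem _ fun i hi => ?_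
  rw [Finset.mem_range] at hi
  rw [x_pow_mul_y_pow]
  refine basis_mem ?_
  rw [add_right_comm, ← map_add]
  exact h _ (by omega)

theorem sub_mem (s : CyclicMonoid m q) : x m q - y m q ∈ graded s (s + cls m q 1) :=
  AddSubgroup.sub_mem _ (basis_mem (by abel)) (basis_mem (by abel))

theorem norm_mem (s : CyclicMonoid m q) :
    norm m q ∈ graded (s + cls m q 1) (s + cls m q m) := by
  refine AddSubgroup.sub_mem _ (dd_mem fun k hk => ?_) (dd_mem fun k hk => ?_)
  · rw [← cls_index_add_period, hk, map_add]; abel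
  · rw [congrArg (cls m q) hk, map_add]; abel

theorem evenHomotopy_mem (hq : 1 ≤ q) {s t : CyclicMonoid m q} {c : EnvRing (CyclicMonoid m q)}
    (hc : c ∈ graded s t) : evenHomotopy m q c ∈ graded (s + cls m q 1) t := by
  refine map_mem_of_basis _ (fun a b hab => ?_) hc
  obtain ⟨i, hi, rfl⟩ := exists_lt_cls_eq hq a
  rw [evenHomotopy, lift_basis, rep_cls hi]
  refine mul_mem (s := cls m q i + s) (dd_mem fun k hk => ?_) (basis_mem ?_)
  · rw [hk, map_add]; abel
  · rw [← hab, zero_add]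

theorem oddHomotopy_mem (hq : 1 ≤ q) {s t : CyclicMonoid m q} {c : EnvRing (CyclicMonoid m q)}
    (hc : c ∈ graded (s + cls m q 1) t) : oddHomotopy m q c ∈ graded (s + cls m q m) t := by
  refine map_mem_of_basis _ (fun a b hab => ?_) hc
  obtain ⟨i, hi, rfl⟩ := exists_lt_cls_eq hq a
  rw [oddHomotopy, lift_basis, rep_cls hi]
  split_ifs with h
  · refine basis_mem ?_
    rw [← hab, ← cls_index_add_period, ← h, map_add]; abel
  · exact AddSubgroup.zero_mem _

/-! ### The periodic resolution -/

variable (m q)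

/-- The map `x - y : free (s + 1) ⟶ free s`. -/
noncomputable def oddDiff (s : CyclicMonoid m q) : free.{u} (s + cls m q 1) ⟶ free.{u} s :=
  free.mul (x m q - y m q) (sub_mem s)

/-- The map `norm : free (s + m) ⟶ free (s + 1)`. -/
noncomputable def evenDiff (s : CyclicMonoid m q) :
    free.{u} (s + cls m q m) ⟶ free.{u} (s + cls m q 1) :=
  free.mul (norm m q) (norm_mem s)

variable {m q}

theorem evenDiff_oddDiff (s : CyclicMonoid m q) :
    evenDiff.{u} m q s ≫ oddDiff.{u} m q s = 0 :=
  free.mul_comp_mul _ _ sub_mul_norm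

theorem oddDiff_evenDiff (s : CyclicMonoid m q) :
    oddDiff.{u} m q (s + cls m q m) ≫ evenDiff.{u} m q s = 0 :=
  free.mul_comp_mul _ _ norm_mul_sub

theorem exact_evenDiff_oddDiff (hq : 1 ≤ q) (s : CyclicMonoid m q) :
    (ShortComplex.mk _ _ (evenDiff_oddDiff.{u} s)).Exact :=
  free.exact_mul _ _ sub_mul_norm fun t c hc h => ⟨oddHomotopy m q c, oddHomotopy_mem hq hc, by
    simpa [h] using norm_mul_oddHomotopy_add hq c⟩

theorem exact_oddDiff_evenDiff (hq : 1 ≤ q) (s : CyclicMonoid m q) :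
    (ShortComplex.mk _ _ (oddDiff_evenDiff.{u} s)).Exact :=
  free.exact_mul _ _ norm_mul_sub fun t c hc h => ⟨evenHomotopy m q c, evenHomotopy_mem hq hc, by
    simpa [h] using sub_mul_evenHomotopy_add hq c⟩

variable (m q)

/-- The augmentation `free 0 ⟶ ℤ`. -/
noncomputable def aug : free.{u} (0 : CyclicMonoid m q) ⟶ trivialHMod.{u} (CyclicMonoid m q) :=
  free.desc (ULift.up (1 : ℤ) : ULift.{u} ℤ)

variable {m q}

/-- The coefficient sum of an element of the enveloping ring in degree `t`, as computed by the
augmentation. -/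
noncomputable def augHom (t : FactCat (CyclicMonoid m q)) :
    EnvRing (CyclicMonoid m q) →+ ULift.{u} ℤ :=
  free.descAux (E := trivialHMod.{u} (CyclicMonoid m q)) (s := 0)
    (ULift.up (1 : ℤ) : ULift.{u} ℤ) t

theorem augHom_basis {t : FactCat (CyclicMonoid m q)} {a b : CyclicMonoid m q}
    (h : a + 0 + b = t.elt) : augHom.{u} t (basis a b) = ULift.up 1 :=
  free.descAux_basis _ h

/-- The homotopy identity at the augmentation: modulo `x - y`, an element of degree `t` is its
coefficient sum times the basis element `(0, t)`. -/
theorem sub_mul_evenHomotopy_add_augHom (hq : 1 ≤ q) (t : FactCat (CyclicMonoid m q))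
    {c : EnvRing (CyclicMonoid m q)} (hc : c ∈ graded 0 t.elt) :
    (x m q - y m q) * evenHomotopy m q c + (augHom.{u} t c).down • basis 0 t.elt = c := by
  refine eq_of_basis ((AddMonoidHom.mulLeft (x m q - y m q)).comp (evenHomotopy m q) +
      (zmultiplesHom _ (basis 0 t.elt)).comp
        ((AddEquiv.ulift.toAddMonoidHom : ULift.{u} ℤ →+ ℤ).comp (augHom.{u} t)))
    (AddMonoidHom.id _) (fun a b hab => ?_) hc
  change (x m q - y m q) * evenHomotopy m q (basis a b) +
    (augHom.{u} t (basis a b)).down • basis 0 t.elt = basis a b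
  rw [augHom_basis hab, one_smul, ← hab]
  obtain ⟨i, hi, rfl⟩ := exists_lt_cls_eq hq a
  obtain ⟨j, rfl⟩ := cls_surjective b
  rw [add_zero, ← map_add, ← x_pow_mul_y_pow, ← y_pow, evenHomotopy_monomial hi, ← mul_assoc,
    sub_mul_dd]
  ring

theorem oddDiff_aug : oddDiff.{u} m q 0 ≫ aug.{u} m q = 0 := by
  ext t c
  change augHom t ((x m q - y m q) * free.val _ t c) = 0
  refine eq_of_basis ((augHom t).comp (AddMonoidHom.mulLeft (x m q - y m q))) 0
    (fun a b hab => ?_) (free.val_mem c)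
  simp only [AddMonoidHom.comp_apply, AddMonoidHom.coe_mulLeft, x, y, sub_mul, basis_mul_basis,
    map_sub]
  rw [augHom_basis (by rw [← hab]; abel), augHom_basis (by rw [← hab]; abel), sub_self]
  rfl

theorem exact_oddDiff_aug (hq : 1 ≤ q) :
    (ShortComplex.mk _ _ (oddDiff_aug.{u} (m := m) (q := q))).Exact := by
  refine ShortComplex.exact_of_evaluation _ fun t => ?_
  rw [ShortComplex.ab_exact_iff]
  intro c hc
  have h0 : augHom.{u} t (free.val _ t c) = 0 := hc
  have := sub_mul_evenHomotopy_add_augHom.{u} hq t (free.val_mem c)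
  rw [h0, ULift.zero_down, zero_smul, add_zero] at this
  exact ⟨free.mk t _ (evenHomotopy_mem hq (free.val_mem c)), free.val_injective this⟩

instance epi_aug : Epi (aug.{u} m q) := by
  rw [NatTrans.epi_iff_epi_app]
  intro t
  rw [AddCommGrpCat.epi_iff_surjective]
  intro (n : ULift.{u} ℤ)
  have hb : (0 : CyclicMonoid m q) + 0 + t.elt = t.elt := by simp
  refine ⟨free.mk t (n.down • basis 0 t.elt) (AddSubgroup.zsmul_mem _ (basis_mem hb) _), ?_⟩
  change augHom t (n.down • basis 0 t.elt) = n
  rw [map_zsmul, augHom_basis hb]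
  ext
  simp

end CyclicMonoid

/-! ### Iterated syzygies -/

/-- `ShiftsTo d X K` records the consequence of `K` being a `d`-th syzygy of `X`: for `n ≥ 1`, the
groups `Extⁿ⁺ᵈ(X, A)` and `Extⁿ(K, A)` are isomorphic, and so are `L_{n + d} F(X)` and `L_n F(K)`
for additive functors `F` to abelian groups. -/
structure ShiftsTo {C : Type*} [Category* C] [Abelian C] [EnoughProjectives C] [HasExt.{u} C]
    (d : ℕ) (X K : C) : Prop where
  ext (A : C) (n : ℕ) : 1 ≤ n → Nonempty (Abelian.Ext X A (n + d) ≃+ Abelian.Ext K A n)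
  leftDerived (F : C ⥤ AddCommGrpCat.{u}) [F.Additive] (n : ℕ) : 1 ≤ n →
    Nonempty ((F.leftDerived (n + d)).obj X ≅ (F.leftDerived n).obj K)

namespace ShiftsTo

variable {C : Type*} [Category* C] [Abelian C] [EnoughProjectives C] [HasExt.{u} C]

theorem of_iso {X K : C} (e : X ≅ K) : ShiftsTo.{u} 0 X K where
  ext A n _ := ⟨{
    toFun := fun x => (Abelian.Ext.mk₀ e.inv).comp x (zero_add n)
    invFun := fun x => (Abelian.Ext.mk₀ e.hom).comp x (zero_add n)
    left_inv := fun x => by simp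
    right_inv := fun x => by simp
    map_add' := fun x y => Abelian.Ext.comp_add _ _ _ _ }⟩
  leftDerived F _ n _ := ⟨(F.leftDerived n).mapIso e⟩

theorem trans {d d' : ℕ} {X K L : C} (h : ShiftsTo.{u} d X K) (h' : ShiftsTo.{u} d' K L) :
    ShiftsTo.{u} (d' + d) X L where
  ext A n hn := by
    obtain ⟨e⟩ := h.ext A (n + d') (by omega)
    obtain ⟨e'⟩ := h'.ext A n hn
    rw [← add_assoc]
    exact ⟨e.trans e'⟩
  leftDerived F _ n hn := by
    obtain ⟨e⟩ := h.leftDerived F (n + d') (by omega)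
    obtain ⟨e'⟩ := h'.leftDerived F n hn
    rw [← add_assoc]
    exact ⟨e.trans e'⟩

theorem of_shortExact {S : ShortComplex C} (hS : S.ShortExact) [Projective S.X₂] :
    ShiftsTo.{u} 1 S.X₃ S.X₁ where
  ext A n hn := by
    obtain ⟨n, rfl⟩ := Nat.exists_eq_add_of_le' hn
    exact hS.nonempty_ext_addEquiv A n
  leftDerived F _ n hn := by
    obtain ⟨n, rfl⟩ := Nat.exists_eq_add_of_le' hn
    exact hS.nonempty_leftDerived_iso F n

/-- If `P ⟶ Q ⟶ R` is exact at `Q` and `R` is projective, the cokernel of `P ⟶ Q` is a syzygy of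
the cokernel of `Q ⟶ R`. -/
theorem of_exact {S : ShortComplex C} (hS : S.Exact) [h : Projective S.X₃] :
    ShiftsTo.{u} 1 (cokernel S.g) (cokernel S.f) :=
  have : Projective (ShortComplex.mk (cokernel.desc S.f S.g S.zero) (cokernel.π S.g) (by
    rw [← cancel_epi (cokernel.π S.f)]; simp)).X₂ := h
  of_shortExact hS.shortExact_cokernelDesc

end ShiftsTo

namespace CyclicMonoid

open FactCat

variable {m q : ℕ}

theorem shiftsTo_cokernel_oddDiff (hq : 1 ≤ q) (s : CyclicMonoid m q) :
    ShiftsTo.{u} 1 (cokernel (oddDiff.{u} m q s)) (cokernel (evenDiff.{u} m q s)) :=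
  have : Projective (ShortComplex.mk _ _ (evenDiff_oddDiff.{u} s)).X₃ :=
    inferInstanceAs (Projective (free.{u} s))
  .of_exact (exact_evenDiff_oddDiff hq s)

theorem shiftsTo_cokernel_evenDiff (hq : 1 ≤ q) (s : CyclicMonoid m q) :
    ShiftsTo.{u} 1 (cokernel (evenDiff.{u} m q s)) (cokernel (oddDiff.{u} m q (s + cls m q m))) :=
  have : Projective (ShortComplex.mk _ _ (oddDiff_evenDiff.{u} s)).X₃ :=
    inferInstanceAs (Projective (free.{u} (s + cls m q 1)))
  .of_exact (exact_oddDiff_evenDiff hq s)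

theorem shiftsTo_cokernel_oddDiff_nsmul (hq : 1 ≤ q) (k : ℕ) (s : CyclicMonoid m q) :
    ShiftsTo.{u} (2 * k) (cokernel (oddDiff.{u} m q s))
      (cokernel (oddDiff.{u} m q (s + cls m q (k * m)))) := by
  induction k with
  | zero => rw [zero_mul, map_zero, add_zero]; exact .of_iso (Iso.refl _)
  | succ k ih =>
    have := ih.trans ((shiftsTo_cokernel_oddDiff hq _).trans (shiftsTo_cokernel_evenDiff hq _))
    rw [add_assoc s, ← map_add, ← Nat.add_one_mul] at this
    rwa [show 2 * (k + 1) = 1 + 1 + 2 * k by omega]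

/-- Since the trivial module is `coker (oddDiff 0)`, the modules `coker (oddDiff (k * m))` are its
syzygies of even order. -/
theorem shiftsTo_trivialHMod (hq : 1 ≤ q) (k : ℕ) :
    ShiftsTo.{u} (2 * k) (trivialHMod.{u} (CyclicMonoid m q))
      (cokernel (oddDiff.{u} m q (cls m q (k * m)))) := by
  have : Epi (ShortComplex.mk _ _ (oddDiff_aug.{u} (m := m) (q := q))).g := epi_aug
  have e : trivialHMod.{u} (CyclicMonoid m q) ≅ cokernel (oddDiff.{u} m q 0) :=
    (exact_oddDiff_aug hq).gIsCokernel.coconePointUniqueUpToIso (colimit.isColimit _)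
  have := (ShiftsTo.of_iso e).trans (shiftsTo_cokernel_oddDiff_nsmul hq k 0)
  rwa [zero_add] at this

/-- For `m = 1` the map `norm` is an endomorphism of `free (s + 1)`, so that its cokernel depends
on `s` through `s + 1` only. -/
theorem nonempty_cokernel_evenDiff_iso {s t : CyclicMonoid 1 q}
    (h : s + cls 1 q 1 = t + cls 1 q 1) :
    Nonempty (cokernel (evenDiff.{u} 1 q s) ≅ cokernel (evenDiff.{u} 1 q t)) := by
  have : ∀ v (hv : norm 1 q ∈ EnvRing.graded (t + cls 1 q 1) (t + cls 1 q 1))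
      (hv' : norm 1 q ∈ EnvRing.graded v v), v = t + cls 1 q 1 →
      Nonempty (cokernel (free.mul.{u} _ hv') ≅ cokernel (free.mul.{u} _ hv)) := by
    rintro _ hv hv' rfl
    exact ⟨Iso.refl _⟩
  exact this _ (norm_mem t) (norm_mem s) h

end CyclicMonoid

/-- If `K` is a syzygy of the trivial module of orders `d` and `d'`, then Leech cohomology and
homology in the degrees `n + d` and `n + d'` agree. -/
theorem ShiftsTo.nonempty_leech {M : Type} [AddMonoid M] {d d' : ℕ} {K : LeftHMod.{u} M}
    (h : ShiftsTo.{u} d (trivialHMod.{u} M) K) (h' : ShiftsTo.{u} d' (trivialHMod.{u} M) K)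
    (A : LeftHMod.{u} M) (B : RightHMod.{u} M) {n : ℕ} (hn : 1 ≤ n) :
    Nonempty (LeechCohomology A (n + d) ≃+ LeechCohomology A (n + d')) ∧
      Nonempty (LeechHomology B (n + d) ≃+ LeechHomology B (n + d')) := by
  obtain ⟨e⟩ := h.ext A n hn
  obtain ⟨e'⟩ := h'.ext A n hn
  obtain ⟨f⟩ := h.leftDerived (hTensor B) n hn
  obtain ⟨f'⟩ := h'.leftDerived (hTensor B) n hn
  exact ⟨⟨e.trans e'.symm⟩, ⟨(f ≪≫ f'.symm).addCommGroupIsoToAddEquiv⟩⟩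

namespace CyclicMonoid

open FactCat

variable {m q : ℕ}

theorem nonempty_leech_of_modEq (hq : 1 ≤ q) (A : LeftHMod.{u} (CyclicMonoid m q))
    (B : RightHMod.{u} (CyclicMonoid m q)) {p n : ℕ} (hp : 3 ≤ p) (hn : 3 ≤ n)
    (h : p ≡ n [MOD 2 * q / Nat.gcd m q]) :
    Nonempty (LeechCohomology A p ≃+ LeechCohomology A n) ∧
      Nonempty (LeechHomology B p ≃+ LeechHomology B n) := by
  rw [Nat.mul_div_assoc _ (Nat.gcd_dvd_right m q)] at h
  -- the shift by an even number of degrees leaves a remainder `j` equal to `1` or `2`; as the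
  -- degrees are at least `3`, both `k` and `l` are positive
  obtain ⟨j, k, l, hj, hk, hl, rfl, rfl⟩ : ∃ j k l, 1 ≤ j ∧ 1 ≤ k ∧ 1 ≤ l ∧
      p = j + 2 * k ∧ n = j + 2 * l := by
    have h2 : p % 2 = n % 2 := h.of_dvd (Dvd.intro _ rfl)
    exact ⟨p - 2 * ((p - 1) / 2), (p - 1) / 2, (n - 1) / 2, by omega, by omega, by omega,
      by omega, by omega⟩
  have hkl : k ≡ l [MOD q / Nat.gcd m q] :=
    Nat.ModEq.mul_left_cancel' two_ne_zero (Nat.ModEq.add_left_cancel' j h)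
  have hkm : k * m ≡ l * m [MOD q] := by
    refine (hkl.mul_right' m).of_dvd ?_
    obtain ⟨g, hg⟩ := Nat.gcd_dvd_left m q
    refine ⟨g, (congrArg (q / Nat.gcd m q * ·) hg).trans ?_⟩
    rw [← mul_assoc, Nat.div_mul_cancel (Nat.gcd_dvd_right m q)]
  have hcls : cls m q (k * m) = cls m q (l * m) :=
    cls_eq_cls.2 (Or.inr ⟨Nat.le_mul_of_pos_left m hk, Nat.le_mul_of_pos_left m hl, hkm⟩)
  have := shiftsTo_trivialHMod.{u} (m := m) hq k
  rw [hcls] at this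
  exact this.nonempty_leech (shiftsTo_trivialHMod hq l) A B hj

theorem nonempty_leech_two_of_modEq (hq : 1 ≤ q) (A : LeftHMod.{u} (CyclicMonoid 1 q))
    (B : RightHMod.{u} (CyclicMonoid 1 q)) {n : ℕ} (hn : 2 ≤ n) (h : n ≡ 2 [MOD 2 * q]) :
    Nonempty (LeechCohomology A n ≃+ LeechCohomology A 2) ∧
      Nonempty (LeechHomology B n ≃+ LeechHomology B 2) := by
  obtain ⟨k, rfl⟩ : ∃ k, n = 1 + (1 + 2 * k) := by
    have h2 : n % 2 = 2 % 2 := h.of_dvd (Dvd.intro _ rfl)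
    exact ⟨(n - 2) / 2, by omega⟩
  have hk : k ≡ 0 [MOD q] := by
    refine Nat.ModEq.mul_left_cancel' two_ne_zero (Nat.ModEq.add_left_cancel' 2 ?_)
    rwa [← add_assoc] at h
  have hcls : cls 1 q (k * 1) + cls 1 q 1 = cls 1 q (0 * 1) + cls 1 q 1 := by
    rw [← map_add, ← map_add]
    refine cls_eq_cls.2 (Or.inr ⟨by omega, by omega, ?_⟩)
    simpa using hk.add_right 1
  obtain ⟨e⟩ := nonempty_cokernel_evenDiff_iso.{u} hcls
  -- both degrees are shifted down to `1`, where the syzygies are isomorphic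
  have h1 := (shiftsTo_trivialHMod.{u} hq k).trans
    ((shiftsTo_cokernel_oddDiff hq _).trans (.of_iso e))
  have h0 := (shiftsTo_trivialHMod.{u} (m := 1) hq 0).trans (shiftsTo_cokernel_oddDiff hq _)
  rw [zero_add] at h1
  exact h1.nonempty_leech h0 A B le_rfl

end CyclicMonoid

theorem mainTheorem4 (m q : ℕ) (hq : 1 ≤ q)
    (A : LeftHMod.{u} (CyclicMonoid m q)) (B : RightHMod.{u} (CyclicMonoid m q)) :
    (∀ p n : ℕ, 3 ≤ p → 3 ≤ n → p ≡ n [MOD 2 * q / Nat.gcd m q] →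
      Nonempty (LeechCohomology A p ≃+ LeechCohomology A n) ∧
      Nonempty (LeechHomology B p ≃+ LeechHomology B n)) ∧
    (m = 1 → ∀ n : ℕ, 2 ≤ n → n ≡ 2 [MOD 2 * q] →
      Nonempty (LeechCohomology A n ≃+ LeechCohomology A 2) ∧
      Nonempty (LeechHomology B n ≃+ LeechHomology B 2)) := by
  refine ⟨fun p n hp hn h => CyclicMonoid.nonempty_leech_of_modEq hq A B hp hn h, ?_⟩
  rintro rfl n hn h
  exact CyclicMonoid.nonempty_leech_two_of_modEq hq A B hn h
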